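/- **Setting.** Let $T\ge 1$ and let $(G_1,\dots,G_T)$ be random finite graphs (multi-edges and loops allowed, vertices and edges labelled from countable sets) defined on a probability space, satisfying - (P1) Markov property: $G_{t+1}\perp\!\!\!\perp(G_1,\dots,G_{t-1})\mid G_t$ for each $t<T$; - (P2) $G_t\subsetneq G_{t+1}$ (strict subgraph) almost surely, for each $t<T$. Let $q^t$ ($2\le t\le T$) be Markov kernels on finite graphs with $q^t(g\mid g')=P(G_t=g\mid G_{t-1}=g')$ whenever $P(G_{t-1}=g')>0$. Fix an observed final graph $g_T$. For a graph $g$ and $t\le T$ let $L^t(g)$ be the bridge likelihood, i.e. the probability that the chain with kernels $q^{t+1},\dots,q^T$ started from $g$ at time $t$ is at $g_T$ at time $T$. Put $$\tau^t(g')=\sum_{g:\,L^t(g)>0}q^t(g\mid g'),\qquad r^t(g\mid g')=\frac{\mathbf 1\{L^t(g)>0\}\,q^t(g\mid g')}{\tau^t(g')} .$$ **Bridge-sampling SMC algorithm** with $N\ge1$ particles and initial law $\nu$. Draw $G_1^i\sim\nu$ independently for $i\le N$ and set $w_1^i=1/N$. For $t=2,\dots,T-1$: draw ancestor indices $A_t^i$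 independently with $P(A_t^i=j)=w_{t-1}^j$; draw $G_t^i\sim r^t(\,\cdot\mid G_{t-1}^{A_t^i})$ and set $G_{1:t}^i=(G_{1:t-1}^{A_t^i},G_t^i)$; compute weights, where $G^i_{t-1}$ and $G^i_t$ denote the last two entries of the path $G^i_{1:t}$, $$\tilde w_t^i=\begin{cases}\tau^t(G_{t-1}^i)& t<T-1,\\ q^T(g_T\mid G_{T-1}^i)\,\tau^{T-1}(G_{T-2}^i)& t=T-1,\end{cases}\qquad w_t^i=\frac{\tilde w_t^i}{\sum_j\tilde w_t^j}.$$ Finally draw $N$ complete sequences $G_{1:T}^i$ independently from the paths $G^j_{1:T-1}$ completed by $G_T=g_T$, with probabilities $w_{T-1}^j$. **Proposition.** Let $f$ be any bounded real function on graph sequences of length $T$. 1. *Fixed initial graph.* If $P(G_1=g_1,\,G_T=g_T)>0$ and the algorithm is started from $\nu=\delta_{g_1}$, then $$\frac1N\sum_{i=1}^N f(G_{1:T}^i)\;\longrightarrow\;\mathbb E\big[f(G_{1:T})\mid G_T=g_T,\,G_1=g_1\big]\quad\text{in probability as }N\to\infty .$$ 2. *Initial graph an unspecified single edge.* Let $T\ge3$,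 and suppose $g_T$ has at least one edge. For an edge $e$ of $g_T$ let $g_T|_e$ be the subgraph consisting of $e$ and its end vertices. Suppose that $P(G_1=g_T|_e,\,G_T=g_T)>0$ for every edge $e$ of $g_T$, and that $P(G_1=g_T|_e)$ is the same for all $e$. If the algorithm is started from $g_T|_e$ with $e$ uniformly distributed on the edges of $g_T$, then $$\frac1N\sum_{i=1}^N f(G_{1:T}^i)\;\longrightarrow\;\mathbb E\big[f(G_{1:T})\mid G_T=g_T,\ G_1\in\{g_T|_e: e\text{ an edge of }g_T\}\big]\quad\text{in probability as }N\to\infty .$$ -/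

import Mathlib

open MeasureTheory ProbabilityTheory Filter Topology
open scoped ENNReal Graph

noncomputable section

/-- Finite graphs with vertex labels in `V` and edge labels in `E`.  Multi-edges and loops are
allowed; simple graphs on `V` are the case `E = Sym2 V`, where the edge `s(x, y)` joins `x` and `y`.
The order is the subgraph relation. -/
abbrev FinGraph (V E : Type*) := {g : Graph V E // V(g).Finite ∧ E(g).Finite}

/-- Every set of finite graphs is measurable. -/
instance FinGraph.instMeasurableSpace (V E : Type*) : MeasurableSpace (FinGraph V E) := ⊤

/-- The subgraph of `g` that consists of the edge `e` and its end vertices. -/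
def FinGraph.singleEdge {V E : Type*} (g : FinGraph V E) (e : E) : FinGraph V E :=
  ⟨{ vertexSet := {x | g.1.Inc e x}
     IsLink := fun e' x y => e' = e ∧ g.1.IsLink e x y
     isLink_symm := fun _ _ => ⟨fun _ _ h => ⟨h.1, h.2.symm⟩⟩
     eq_or_eq_of_isLink_of_isLink := fun _ _ _ _ _ h h' => h.2.left_eq_or_eq h'.2
     left_mem_of_isLink := fun _ _ _ h => h.2.inc_left },
   g.2.1.subset fun _ h => h.vertex_mem,
   (Set.finite_singleton e).subset (by rintro e' ⟨x, y, h, -⟩; exact h)⟩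

/-- The random graphs `G 1, …, G T` form a sequential network model with transition kernels
`q 2, …, q T`. -/
structure IsSequentialNetworkModel {V E Ω : Type*} [MeasurableSpace Ω] (μ : Measure Ω) (T : ℕ)
    (G : ℕ → Ω → FinGraph V E) (q : ℕ → FinGraph V E → PMF (FinGraph V E)) : Prop where
  measurable : ∀ t, 1 ≤ t → t ≤ T → Measurable (G t)
  /-- `q t` is the transition kernel of step `t`: `q t g' g = P(G t = g | G (t - 1) = g')` for
  every `g'` for which this conditional probability is defined. -/
  kernel : ∀ t, 1 ≤ t → t < T → ∀ g', μ (G t ⁻¹' {g'}) ≠ 0 →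
    ∀ g, (μ[|G t ⁻¹' {g'}]) (G (t + 1) ⁻¹' {g}) = q (t + 1) g' g
  /-- (P1), the Markov property: `G (t + 1)` and `(G 1, …, G (t - 1))` are conditionally
  independent given `G t`. -/
  markov : ∀ t, 1 ≤ t → t < T → ∀ g,
    IndepFun (G (t + 1)) (fun ω (s : Finset.Ico 1 t) => G s ω) (μ[|G t ⁻¹' {g}])
  /-- (P2): the sequence is strictly increasing, almost surely. -/
  strictly_increasing : ∀ t, 1 ≤ t → t < T → ∀ᵐ ω ∂μ, G t ω < G (t + 1) ω

namespace BridgeSampling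

/-! In this section `X` is the state space of the model, that is, the set of finite graphs. -/

variable {X : Type*}

/-- `multiStep q s n g` is the law at time `s + n` of the chain with kernels `q` that is in state
`g` at time `s`. -/
def multiStep (q : ℕ → X → PMF X) : (s n : ℕ) → X → PMF X
  | _, 0, g => PMF.pure g
  | s, n + 1, g => (q (s + 1) g).bind (multiStep q (s + 1) n)

/-- The bridge likelihood `L t g`, the probability that the chain is in state `gT` at time `T`
if it is in state `g` at time `t ≤ T`. -/
def bridgeLikelihood (q : ℕ → X → PMF X) (T : ℕ) (gT : X) (t : ℕ) (g : X) : ℝ≥0∞ :=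
  multiStep q t (T - t) g gT

/-- The states that are feasible at time `t`. -/
def feasible (q : ℕ → X → PMF X) (T : ℕ) (gT : X) (t : ℕ) : Set X :=
  {g | 0 < bridgeLikelihood q T gT t g}

/-- `τ t g' = ∑ q t g' g`, where `g` ranges over the states that are feasible at time `t`. -/
def tau (q : ℕ → X → PMF X) (T : ℕ) (gT : X) (t : ℕ) (g' : X) : ℝ≥0∞ :=
  ∑' g, (feasible q T gT t).indicator (q t g') g

open Classical in
/-- The proposal kernel `r t g' g = 1{L t g > 0} * q t g' g / τ t g'`.  If `τ t g' = 0`, the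
quotient is undefined, and the value is an arbitrary law (the unit mass at `g'`). -/
def proposal (q : ℕ → X → PMF X) (T : ℕ) (gT : X) (t : ℕ) (g' : X) : PMF X :=
  if h : ∃ g ∈ feasible q T gT t, g ∈ (q t g').support then
    (q t g').filter (feasible q T gT t) h
  else PMF.pure g'

theorem proposal_apply (q : ℕ → X → PMF X) (T : ℕ) (gT : X) (t : ℕ) (g' g : X)
    (h : tau q T gT t g' ≠ 0) :
    proposal q T gT t g' g =
      (feasible q T gT t).indicator (q t g') g / tau q T gT t g' := by
  have h' : ∃ g ∈ feasible q T gT t, g ∈ (q t g').support := by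
    by_contra hc
    push Not at hc
    refine h (ENNReal.tsum_eq_zero.2 fun a => ?_)
    by_cases ha : a ∈ feasible q T gT t
    · rw [Set.indicator_of_mem ha]
      exact (PMF.apply_eq_zero_iff _ _).2 (hc a ha)
    · exact Set.indicator_of_notMem ha _
  rw [proposal, dif_pos h', PMF.filter_apply, div_eq_mul_inv, tau]

/-- The unnormalized weight at time `t` of a particle with path `z`, whose entries `z 1, …, z t`
are its states at the times `1, …, t`.  All weights at time `1` are equal. -/
def weight (q : ℕ → X → PMF X) (T : ℕ) (gT : X) (t : ℕ) (z : ℕ → X) : ℝ≥0∞ :=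
  if t ≤ 1 then 1
  else if t + 1 < T then tau q T gT t (z (t - 1))
  else q T (z t) gT * tau q T gT t (z (t - 1))

/-- The law of `n` independent draws from `p`. -/
def iid {Y : Type*} (p : PMF Y) : (n : ℕ) → PMF (Fin n → Y)
  | 0 => PMF.pure Fin.elim0
  | n + 1 => p.bind fun a => (iid p n).map fun v => (Fin.cons a v : Fin (n + 1) → Y)

open Classical in
/-- The law on indices with probabilities proportional to the weights `w`.  If the weights cannot
be normalized, the value is an arbitrary law (the uniform one). -/
def resampleIndex {N : ℕ} [NeZero N] (w : Fin N → ℝ≥0∞) : PMF (Fin N) :=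
  if h : ∑' i, w i ≠ 0 ∧ ∑' i, w i ≠ ∞ then PMF.normalize w h.1 h.2
  else PMF.uniformOfFintype (Fin N)

/-- The law of the paths of the `N` particles after `k` iterations of the sampler, that is, at time
`k + 1`.  The initial states are independent draws from `ν`.  In the iteration that leads to time
`t = k + 2`, each particle independently draws an ancestor index `a` with probabilities
proportional to the weights at time `t - 1`, and extends the path of its ancestor by a draw `g`
from the proposal kernel.  Entries of a path at times outside `{1, …, k + 1}` play no role. -/
def particles (q : ℕ → X → PMF X) (T : ℕ) (gT : X) (ν : PMF X) (N : ℕ) [NeZero N] :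
    ℕ → PMF (Fin N → ℕ → X)
  | 0 => iid (ν.map fun g _ => g) N
  | k + 1 => (particles q T gT ν N k).bind fun Z =>
      iid ((resampleIndex fun i => weight q T gT (k + 1) (Z i)).bind fun a =>
        (proposal q T gT (k + 2) (Z a (k + 1))).map fun g => Function.update (Z a) (k + 2) g) N

/-- The bridge sampling algorithm with `N` particles, observed final state `gT` and initial law
`ν`: the law of its output, an array of `N` sequences with index set `{1, …, T}`.  The particles
are propagated up to time `T - 1`; then `N` paths are resampled with probabilities proportional to
the weights at time `T - 1`, and completed by the observed state at time `T`. -/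
def bridgeSampler (q : ℕ → X → PMF X) (T : ℕ) (gT : X) (ν : PMF X) (N : ℕ) [NeZero N] :
    PMF (Fin N → Finset.Icc 1 T → X) :=
  (particles q T gT ν N (T - 2)).bind fun Z =>
    iid ((resampleIndex fun i => weight q T gT (T - 1) (Z i)).map fun a =>
      (Finset.Icc 1 T).restrict (Function.update (Z a) T gT)) N

/-- The averages `(1/N) ∑ i, f (Xᵢ)` over the output of the bridge sampling algorithm with `N ≥ 1`
particles converge in probability to `c` as `N → ∞`. -/
def ConsistentFor [MeasurableSpace X] (q : ℕ → X → PMF X) (T : ℕ) (gT : X) (ν : PMF X)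
    (f : (Finset.Icc 1 T → X) → ℝ) (c : ℝ) : Prop :=
  ∀ ε : ℝ, 0 < ε → Tendsto
    (fun n : ℕ => (bridgeSampler q T gT ν (n + 1)).toMeasure
      {x | ε ≤ |((n + 1 : ℕ) : ℝ)⁻¹ * (∑ i, f (x i)) - c|})
    atTop (𝓝 0)

end BridgeSampling

end

/-! Write `r` for the proposal kernel. Whenever `τ t g' ≠ 0`, the weight cancels the normalization
of the proposal: `τ t g' * r t g' g = q t g' g * 1{g feasible at t}`. When `τ t g' = 0`, both sides
vanish once the proposal is multiplied by `τ` (`proposal_mul_tau`). So selection by weights followed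
by mutation turns an approximation of the chain restricted to paths ending in a feasible state into
the same approximation one step later, up to a positive constant (`exists_avgTendsto_particles`).
The extra factor `q T (z (T - 1)) gT` in the last weight vanishes off the feasible states. It tilts
the limit to the bridge, and the constants cancel in the ratio of averages
(`avgTendsto_bridgeSampler`).

Convergence is carried in mean. Given the current particles, the new ones are i.i.d., so a
second-moment bound controls the sampling error (`mean_iid_abs_avg_sub_le`). The conditional mean is
a ratio of two averages that converge by induction (`AvgTendsto.resample`). The limiting
denominators are positive because every initial state is feasible.

On the model side, the Markov property identifies the law of the process on `G 1 ∈ S` with a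
multiple of the law of the chain with kernels `q` (`lintegral_processPath`). Integrating out the
last transition expresses the conditional expectation as the same ratio
(`integral_cond_eq_mean_chain`). Both parts are instances: `S` is a singleton, or the set of
single-edge subgraphs. For `T ≤ 2` the weights are constant and the path is determined by its
endpoints. -/

/-- The expectation of a real function under a discrete law. -/
noncomputable def PMF.mean {α : Type*} (p : PMF α) (φ : α → ℝ) : ℝ := ∑' x, (p x).toReal * φ x

/-- A real function is bounded. -/
def IsBddFun {α : Type*} (φ : α → ℝ) : Prop := ∃ K, ∀ x, |φ x| ≤ K

/-! ### Closure properties of bounded functions -/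

namespace IsBddFun

variable {α β : Type*} {φ ψ : α → ℝ}

theorem const (c : ℝ) : IsBddFun (fun _ : α => c) := ⟨|c|, fun _ => le_rfl⟩

theorem add (hφ : IsBddFun φ) (hψ : IsBddFun ψ) : IsBddFun fun x => φ x + ψ x := by
  obtain ⟨K, hK⟩ := hφ
  obtain ⟨L, hL⟩ := hψ
  exact ⟨K + L, fun x => (abs_add_le _ _).trans (add_le_add (hK x) (hL x))⟩

theorem mul (hφ : IsBddFun φ) (hψ : IsBddFun ψ) : IsBddFun fun x => φ x * ψ x := by
  obtain ⟨K, hK⟩ := hφ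
  obtain ⟨L, hL⟩ := hψ
  refine ⟨K * L, fun x => ?_⟩
  rw [abs_mul]
  exact mul_le_mul (hK x) (hL x) (abs_nonneg _) ((abs_nonneg _).trans (hK x))

theorem sub (hφ : IsBddFun φ) (hψ : IsBddFun ψ) : IsBddFun fun x => φ x - ψ x := by
  simpa [sub_eq_add_neg] using hφ.add ((const (-1)).mul hψ)

theorem abs (hφ : IsBddFun φ) : IsBddFun fun x => |φ x| := by
  obtain ⟨K, hK⟩ := hφ
  exact ⟨K, fun x => by simpa using hK x⟩

theorem sum {ι : Type*} (s : Finset ι) {φ : ι → α → ℝ} (h : ∀ i, IsBddFun (φ i)) :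
    IsBddFun fun x => ∑ i ∈ s, φ i x := by
  choose K hK using h
  exact ⟨∑ i ∈ s, K i, fun x => (Finset.abs_sum_le_sum_abs _ _).trans
    (Finset.sum_le_sum fun i _ => hK i x)⟩

theorem comp (hφ : IsBddFun φ) (f : β → α) : IsBddFun fun x => φ (f x) := by
  obtain ⟨K, hK⟩ := hφ
  exact ⟨K, fun x => hK _⟩

theorem indicator_one (s : Set α) : IsBddFun (s.indicator (1 : α → ℝ)) := by
  refine ⟨1, fun x => ?_⟩
  by_cases h : x ∈ s <;> simp [h]

theorem toReal {w : α → ℝ≥0∞} (hw : ∀ x, w x ≤ 1) : IsBddFun fun x => (w x).toReal :=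
  ⟨1, fun x => by
    rw [abs_of_nonneg ENNReal.toReal_nonneg]
    simpa using ENNReal.toReal_mono ENNReal.one_ne_top (hw x)⟩

end IsBddFun

/-! ### Calculus of expectations under discrete laws -/

namespace PMF

variable {α β : Type*} (p : PMF α) {φ ψ : α → ℝ}

theorem summable_toReal : Summable fun x => (p x).toReal :=
  ENNReal.summable_toReal p.tsum_coe_ne_top

theorem tsum_toReal : ∑' x, (p x).toReal = 1 := by
  rw [← ENNReal.tsum_toReal_eq fun x => p.apply_ne_top x, p.tsum_coe, ENNReal.toReal_one]

theorem summable_mean (hφ : IsBddFun φ) : Summable fun x => (p x).toReal * φ x := by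
  obtain ⟨K, hK⟩ := hφ
  refine Summable.of_norm_bounded (p.summable_toReal.mul_right K) fun x => ?_
  rw [Real.norm_eq_abs, abs_mul, abs_of_nonneg ENNReal.toReal_nonneg]
  exact mul_le_mul_of_nonneg_left (hK x) ENNReal.toReal_nonneg

theorem mean_const (c : ℝ) : p.mean (fun _ => c) = c := by
  rw [mean, tsum_mul_right, tsum_toReal, one_mul]

theorem mean_add (hφ : IsBddFun φ) (hψ : IsBddFun ψ) :
    p.mean (fun x => φ x + ψ x) = p.mean φ + p.mean ψ := by
  simp only [mean, mul_add]
  exact (p.summable_mean hφ).tsum_add (p.summable_mean hψ)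

theorem mean_const_mul (c : ℝ) (φ : α → ℝ) : p.mean (fun x => c * φ x) = c * p.mean φ := by
  simp only [mean, ← tsum_mul_left]
  exact tsum_congr fun x => by ring

theorem mean_sub (hφ : IsBddFun φ) (hψ : IsBddFun ψ) :
    p.mean (fun x => φ x - ψ x) = p.mean φ - p.mean ψ := by
  simp only [mean, mul_sub]
  exact (p.summable_mean hφ).tsum_sub (p.summable_mean hψ)

theorem mean_mono (hφ : IsBddFun φ) (hψ : IsBddFun ψ) (h : ∀ x, φ x ≤ ψ x) :
    p.mean φ ≤ p.mean ψ :=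
  (p.summable_mean hφ).tsum_le_tsum
    (fun x => mul_le_mul_of_nonneg_left (h x) ENNReal.toReal_nonneg) (p.summable_mean hψ)

theorem mean_nonneg (h : ∀ x, 0 ≤ φ x) : 0 ≤ p.mean φ :=
  tsum_nonneg fun x => mul_nonneg ENNReal.toReal_nonneg (h x)

theorem mean_pos (hφ : IsBddFun φ) (h : ∀ x, 0 ≤ φ x) {x : α} (hx : x ∈ p.support)
    (hpos : 0 < φ x) : 0 < p.mean φ :=
  (p.summable_mean hφ).tsum_pos (fun x => mul_nonneg ENNReal.toReal_nonneg (h x)) x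
    (mul_pos (ENNReal.toReal_pos ((p.mem_support_iff x).1 hx) (p.apply_ne_top x)) hpos)

theorem mean_congr (h : ∀ x ∈ p.support, φ x = ψ x) : p.mean φ = p.mean ψ := by
  refine tsum_congr fun x => ?_
  by_cases hx : x ∈ p.support
  · rw [h x hx]
  · simp [(p.apply_eq_zero_iff x).2 hx]

theorem abs_mean_le {K : ℝ} (h : ∀ x, |φ x| ≤ K) : |p.mean φ| ≤ K := by
  have hφ : IsBddFun φ := ⟨K, h⟩
  refine abs_le.2 ⟨?_, ?_⟩
  · rw [← p.mean_const (-K)]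
    exact p.mean_mono (.const _) hφ fun x => (abs_le.1 (h x)).1
  · rw [← p.mean_const K]
    exact p.mean_mono hφ (.const _) fun x => (abs_le.1 (h x)).2

theorem isBddFun_mean (κ : α → PMF β) {φ : α → β → ℝ} {K : ℝ} (h : ∀ x y, |φ x y| ≤ K) :
    IsBddFun fun x => (κ x).mean (φ x) :=
  ⟨K, fun x => (κ x).abs_mean_le (h x)⟩

theorem mean_eq_toReal (h : ∀ x, 0 ≤ φ x) :
    p.mean φ = (∑' x, p x * ENNReal.ofReal (φ x)).toReal := by
  rw [ENNReal.tsum_toReal_eq fun x => ENNReal.mul_ne_top (p.apply_ne_top x) ENNReal.ofReal_ne_top]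
  exact tsum_congr fun x => by rw [ENNReal.toReal_mul, ENNReal.toReal_ofReal (h x)]

theorem tsum_bind_mul (κ : α → PMF β) (φ : β → ℝ≥0∞) :
    ∑' y, (p.bind κ) y * φ y = ∑' x, p x * ∑' y, κ x y * φ y := by
  simp only [bind_apply, ← ENNReal.tsum_mul_right, ← ENNReal.tsum_mul_left, mul_assoc]
  exact ENNReal.tsum_comm

theorem tsum_pure_mul (a : α) (φ : α → ℝ≥0∞) : ∑' x, (pure a) x * φ x = φ a := by
  rw [tsum_eq_single a fun x hx => by rw [pure_apply_of_ne _ _ hx, zero_mul], pure_apply_self,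
    one_mul]

theorem tsum_map_mul (f : α → β) (φ : β → ℝ≥0∞) :
    ∑' y, (p.map f) y * φ y = ∑' x, p x * φ (f x) := by
  rw [map, tsum_bind_mul]
  simp only [Function.comp_apply, tsum_pure_mul]

theorem tsum_mul_ofReal_ne_top (hφ : IsBddFun φ) : ∑' x, p x * ENNReal.ofReal (φ x) ≠ ∞ := by
  obtain ⟨K, hK⟩ := hφ
  refine ((ENNReal.tsum_le_tsum fun x => mul_le_mul_right
    (ENNReal.ofReal_le_ofReal ((le_abs_self _).trans (hK x))) (p x)).trans_lt ?_).ne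
  rw [ENNReal.tsum_mul_right, p.tsum_coe, one_mul]
  exact ENNReal.ofReal_lt_top

/-- For nonnegative functions this is Tonelli in `ℝ≥0∞`; a bounded function becomes nonnegative
after adding a constant, which both sides respect. -/
theorem mean_bind (κ : α → PMF β) {φ : β → ℝ} (hφ : IsBddFun φ) :
    (p.bind κ).mean φ = p.mean fun x => (κ x).mean φ := by
  have key : ∀ ψ : β → ℝ, (∀ x, 0 ≤ ψ x) → IsBddFun ψ →
      (p.bind κ).mean ψ = p.mean fun x => (κ x).mean ψ := by
    intro ψ h hψ
    rw [mean_eq_toReal _ h, mean_eq_toReal _ fun x => mean_nonneg _ h, tsum_bind_mul]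
    congr 1
    refine tsum_congr fun x => ?_
    rw [mean_eq_toReal _ h, ENNReal.ofReal_toReal ((κ x).tsum_mul_ofReal_ne_top hψ)]
  obtain ⟨K, hK⟩ := hφ
  have hφ : IsBddFun φ := ⟨K, hK⟩
  have h := key (fun x => φ x + K) (fun x => by linarith [neg_abs_le (φ x), hK x])
    (hφ.add (.const K))
  simp only [mean_add _ hφ (.const K), mean_const] at h
  rw [p.mean_add (isBddFun_mean κ fun _ => hK) (.const K), mean_const] at h
  linarith

theorem mean_pure (a : α) (φ : α → ℝ) : (pure a).mean φ = φ a := by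
  rw [mean, tsum_eq_single a fun x hx => by simp [pure_apply_of_ne _ _ hx]]
  simp

theorem mean_map (f : α → β) {φ : β → ℝ} (hφ : IsBddFun φ) :
    (p.map f).mean φ = p.mean fun x => φ (f x) := by
  rw [map, mean_bind _ _ hφ]
  simp only [Function.comp_apply, mean_pure]

theorem mean_fintype [Fintype α] (φ : α → ℝ) : p.mean φ = ∑ x, (p x).toReal * φ x :=
  tsum_fintype _

end PMF

/-! ### Law of large numbers and one selection-mutation step -/

namespace BridgeSampling

theorem mean_iid_succ {Y : Type*} (p : PMF Y) (n : ℕ) {F : (Fin (n + 1) → Y) → ℝ}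
    (hF : IsBddFun F) :
    (iid p (n + 1)).mean F = p.mean fun a => (iid p n).mean fun v => F (Fin.cons a v) := by
  rw [iid, PMF.mean_bind _ _ hF]
  congr 1
  funext a
  exact PMF.mean_map _ _ hF

/-- Split off the first draw and expand the square: the cross term vanishes because the remaining
sum has mean zero, so each draw adds at most `K ^ 2`. The first conjunct is what the induction needs
for this. -/
theorem mean_iid_sum_sq_le {Y : Type*} (p : PMF Y) {φ : Y → ℝ} {K : ℝ} (hK : ∀ y, |φ y| ≤ K)
    (h0 : p.mean φ = 0) (n : ℕ) :
    (iid p n).mean (fun v => ∑ i, φ (v i)) = 0 ∧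
      (iid p n).mean (fun v => (∑ i, φ (v i)) * ∑ i, φ (v i)) ≤ n * K ^ 2 := by
  have hφ : IsBddFun φ := ⟨K, hK⟩
  have hS : ∀ m, IsBddFun fun v : Fin m → Y => ∑ i, φ (v i) := fun m =>
    IsBddFun.sum _ fun i => hφ.comp fun v : Fin m → Y => v i
  induction n with
  | zero => simp [PMF.mean_const]
  | succ n ih =>
    have hcons : ∀ a : Y, (iid p n).mean (fun v => φ a + ∑ i, φ (v i)) = φ a := fun a => by
      rw [PMF.mean_add _ (.const _) (hS n), ih.1, PMF.mean_const, add_zero]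
    constructor
    · rw [mean_iid_succ p n (hS _)]
      simp only [Fin.sum_univ_succ, Fin.cons_zero, Fin.cons_succ, hcons, h0]
    · rw [mean_iid_succ p n ((hS _).mul (hS _))]
      simp only [Fin.sum_univ_succ, Fin.cons_zero, Fin.cons_succ]
      have hsq : ∀ a : Y, (iid p n).mean
          (fun v => (φ a + ∑ i, φ (v i)) * (φ a + ∑ i, φ (v i))) =
          φ a * φ a + (iid p n).mean (fun v => (∑ i, φ (v i)) * ∑ i, φ (v i)) := fun a => by
        have : (fun v : Fin n → Y => (φ a + ∑ i, φ (v i)) * (φ a + ∑ i, φ (v i))) = fun v =>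
            (φ a * φ a + (2 * φ a) * ∑ i, φ (v i)) + (∑ i, φ (v i)) * ∑ i, φ (v i) := by
          funext v; ring
        rw [this, PMF.mean_add _ ((IsBddFun.const _).add ((IsBddFun.const _).mul (hS n)))
          ((hS n).mul (hS n)), PMF.mean_add _ (.const _) ((IsBddFun.const _).mul (hS n)),
          PMF.mean_const, PMF.mean_const_mul, ih.1, mul_zero, add_zero]
      simp only [hsq]
      rw [PMF.mean_add _ (hφ.mul hφ) (.const _), PMF.mean_const]
      have : p.mean (fun a => φ a * φ a) ≤ K ^ 2 := by
        rw [← p.mean_const (K ^ 2)]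
        refine p.mean_mono (hφ.mul hφ) (.const _) fun a => ?_
        nlinarith [abs_mul_abs_self (φ a), hK a, abs_nonneg (φ a)]
      push_cast
      linarith [ih.2]

/-- The average of `φ` over a family of points. -/
noncomputable def avg {Y : Type*} (φ : Y → ℝ) {n : ℕ} (Z : Fin n → Y) : ℝ := (n : ℝ)⁻¹ * ∑ i, φ (Z i)

theorem isBddFun_avg {Y : Type*} {φ : Y → ℝ} (hφ : IsBddFun φ) (n : ℕ) :
    IsBddFun fun Z : Fin n → Y => avg φ Z :=
  (IsBddFun.const _).mul (IsBddFun.sum _ fun i => hφ.comp fun Z : Fin n → Y => Z i)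

/-- The law of large numbers in mean, with the rate `n ^ (-1 / 2)`. -/
theorem mean_iid_abs_avg_sub_le {Y : Type*} (p : PMF Y) {φ : Y → ℝ} {K : ℝ}
    (hK : ∀ y, |φ y| ≤ K) (n : ℕ) :
    (iid p (n + 1)).mean (fun v => |avg φ v - p.mean φ|) ≤
      (1 + (2 * K) ^ 2) * (√((n + 1 : ℕ) : ℝ))⁻¹ := by
  have hφ : IsBddFun φ := ⟨K, hK⟩
  set N : ℝ := ((n + 1 : ℕ) : ℝ) with hN
  have hNpos : 0 < N := by positivity
  set s := √N with hs
  have hspos : 0 < s := Real.sqrt_pos.2 hNpos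
  have hss : s * s = N := Real.mul_self_sqrt hNpos.le
  set m := p.mean φ with hm
  set ψ : Y → ℝ := fun y => φ y - m with hψ
  have hψK : ∀ y, |ψ y| ≤ 2 * K := fun y => by
    have h1 := p.abs_mean_le hK
    have h2 := abs_sub (φ y) m
    have h3 := hK y
    simp only [hψ]
    linarith
  have hψb : IsBddFun ψ := ⟨_, hψK⟩
  have hψ0 : p.mean ψ = 0 := by
    rw [hψ, PMF.mean_sub _ hφ (.const _), PMF.mean_const, ← hm, sub_self]
  obtain ⟨-, h2⟩ := mean_iid_sum_sq_le p hψK hψ0 (n + 1)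
  have havg : ∀ v : Fin (n + 1) → Y, avg φ v - m = N⁻¹ * ∑ i, ψ (v i) := fun v => by
    simp only [avg, hψ, Finset.sum_sub_distrib, Finset.sum_const, Finset.card_univ,
      Fintype.card_fin, nsmul_eq_mul, ← hN]
    field_simp
  have hSb : IsBddFun fun v : Fin (n + 1) → Y => ∑ i, ψ (v i) :=
    IsBddFun.sum _ fun i => hψb.comp fun v : Fin (n + 1) → Y => v i
  calc (iid p (n + 1)).mean (fun v => |avg φ v - m|)
      ≤ (iid p (n + 1)).mean (fun v => s⁻¹ + (s⁻¹ * N⁻¹) * ((∑ i, ψ (v i)) * ∑ i, ψ (v i))) := by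
        refine PMF.mean_mono _ ((isBddFun_avg hφ _).sub (.const _)).abs
          ((IsBddFun.const _).add ((IsBddFun.const _).mul (hSb.mul hSb))) fun v => ?_
        -- With `x = |S| / s` and `N = s * s`, the claim is `x ≤ 1 + x ^ 2` divided by `s`. This
        -- replaces Cauchy-Schwarz in passing from the second moment to the first.
        rw [havg, abs_mul, abs_of_pos (inv_pos.2 hNpos), ← hss]
        set S := ∑ i, ψ (v i)
        rw [← abs_mul_abs_self S]
        have : s⁻¹ + s⁻¹ * (s * s)⁻¹ * (|S| * |S|) - (s * s)⁻¹ * |S| =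
            s⁻¹ * ((1 - s⁻¹ * |S| / 2) ^ 2 + 3 / 4 * (s⁻¹ * |S|) ^ 2) := by
          field_simp
          ring
        have h0 : 0 ≤ s⁻¹ * ((1 - s⁻¹ * |S| / 2) ^ 2 + 3 / 4 * (s⁻¹ * |S|) ^ 2) := by positivity
        linarith
    _ = s⁻¹ + (s⁻¹ * N⁻¹) *
          (iid p (n + 1)).mean (fun v => (∑ i, ψ (v i)) * ∑ i, ψ (v i)) := by
        rw [PMF.mean_add _ (.const _) ((IsBddFun.const _).mul (hSb.mul hSb)), PMF.mean_const,
          PMF.mean_const_mul]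
    _ ≤ s⁻¹ + (s⁻¹ * N⁻¹) * (N * (2 * K) ^ 2) := by gcongr
    _ = (1 + (2 * K) ^ 2) * s⁻¹ := by field_simp

/-- The averages of `φ` over arrays with laws `P n` converge in mean to `c`. -/
def AvgTendsto {Y : Type*} (P : ∀ n : ℕ, PMF (Fin (n + 1) → Y)) (φ : Y → ℝ) (c : ℝ) : Prop :=
  Tendsto (fun n => (P n).mean fun Z => |avg φ Z - c|) atTop (𝓝 0)

theorem tendsto_const_mul_inv_sqrt (C : ℝ) :
    Tendsto (fun n : ℕ => C * (√((n + 1 : ℕ) : ℝ))⁻¹) atTop (𝓝 0) := by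
  rw [← mul_zero C]
  exact ((tendsto_inv_atTop_zero.comp Real.tendsto_sqrt_atTop).comp
    (tendsto_natCast_atTop_atTop.comp (tendsto_add_atTop_nat 1))).const_mul C

theorem avgTendsto_iid {Y : Type*} (p : PMF Y) {φ : Y → ℝ} (hφ : IsBddFun φ) :
    AvgTendsto (fun n => iid p (n + 1)) φ (p.mean φ) := by
  obtain ⟨K, hK⟩ := hφ
  exact squeeze_zero (fun n => PMF.mean_nonneg _ fun _ => abs_nonneg _)
    (fun n => mean_iid_abs_avg_sub_le p hK n) (tendsto_const_mul_inv_sqrt _)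

/-- The multiplied form also covers weights that are all zero, where the resampling law is arbitrary
but both sides vanish. -/
theorem mean_resampleIndex {N : ℕ} [NeZero N] {w : Fin N → ℝ≥0∞} (hw : ∀ i, w i ≠ ∞)
    (ψ : Fin N → ℝ) :
    (resampleIndex w).mean ψ * ∑ i, (w i).toReal = ∑ i, (w i).toReal * ψ i := by
  have htop : ∑' i, w i ≠ ∞ := by
    rw [tsum_fintype]
    exact ENNReal.sum_ne_top.2 fun i _ => hw i
  have hsum : (∑' i, w i).toReal = ∑ i, (w i).toReal := by
    rw [tsum_fintype, ENNReal.toReal_sum fun i _ => hw i]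
  by_cases h0 : ∑' i, w i = 0
  · have : ∀ i, w i = 0 := ENNReal.tsum_eq_zero.1 h0
    simp [this]
  · rw [resampleIndex, dif_pos ⟨h0, htop⟩, PMF.mean_fintype, Finset.sum_mul, ← hsum]
    refine Finset.sum_congr rfl fun i _ => ?_
    rw [PMF.normalize_apply, ENNReal.toReal_mul, ENNReal.toReal_inv]
    have : (∑' i, w i).toReal ≠ 0 := (ENNReal.toReal_pos h0 htop).ne'
    field_simp

/-- One step of a particle system (selection by the weights `w`, mutation by the kernel `κ`)
preserves the convergence of averages. -/
theorem AvgTendsto.resample {Y Y' : Type*} {P : ∀ n : ℕ, PMF (Fin (n + 1) → Y)} {w : Y → ℝ≥0∞}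
    (hw : ∀ y, w y ≤ 1) (κ : Y → PMF Y') {φ : Y' → ℝ} (hφ : IsBddFun φ) {a b : ℝ} (hb : 0 < b)
    (ha : AvgTendsto P (fun y => (w y).toReal * (κ y).mean φ) a)
    (hwb : AvgTendsto P (fun y => (w y).toReal) b) :
    AvgTendsto (fun n => (P n).bind fun Z =>
      iid ((resampleIndex fun i => w (Z i)).bind fun i => κ (Z i)) (n + 1)) φ (a / b) := by
  obtain ⟨K, hK⟩ := hφ
  have hφ : IsBddFun φ := ⟨K, hK⟩
  have hwbdd : IsBddFun fun y => (w y).toReal := .toReal hw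
  have hκ : IsBddFun fun y => (κ y).mean φ := PMF.isBddFun_mean κ fun _ => hK
  have hlim : Tendsto (fun n : ℕ => (1 + (2 * K) ^ 2) * (√((n + 1 : ℕ) : ℝ))⁻¹ +
      ((K / b) * (P n).mean (fun Z => |avg (fun y => (w y).toReal) Z - b|) +
        b⁻¹ * (P n).mean (fun Z => |avg (fun y => (w y).toReal * (κ y).mean φ) Z - a|)))
      atTop (𝓝 0) := by
    have := (tendsto_const_mul_inv_sqrt (1 + (2 * K) ^ 2)).add
      ((hwb.const_mul (K / b)).add (ha.const_mul b⁻¹))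
    simpa using this
  refine squeeze_zero (fun n => PMF.mean_nonneg _ fun _ => abs_nonneg _) (fun n => ?_) hlim
  have hb1 : IsBddFun fun Z : Fin (n + 1) → Y => |avg (fun y => (w y).toReal) Z - b| :=
    ((isBddFun_avg hwbdd _).sub (.const _)).abs
  have hb2 : IsBddFun fun Z : Fin (n + 1) → Y =>
      |avg (fun y => (w y).toReal * (κ y).mean φ) Z - a| :=
    ((isBddFun_avg (hwbdd.mul hκ) _).sub (.const _)).abs
  have hbd : IsBddFun fun v : Fin (n + 1) → Y' => |avg φ v - a / b| :=
    ((isBddFun_avg hφ _).sub (.const _)).abs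
  rw [PMF.mean_bind _ _ hbd, ← PMF.mean_const_mul, ← PMF.mean_const_mul,
    ← PMF.mean_add _ ((IsBddFun.const _).mul hb1) ((IsBddFun.const _).mul hb2),
    ← (P n).mean_const ((1 + (2 * K) ^ 2) * (√((n + 1 : ℕ) : ℝ))⁻¹),
    ← PMF.mean_add _ (.const _)
      (((IsBddFun.const _).mul hb1).add ((IsBddFun.const _).mul hb2))]
  obtain ⟨B, hB⟩ := hbd
  refine PMF.mean_mono _ (PMF.isBddFun_mean _ fun _ v => hB v) ((IsBddFun.const _).add
      (((IsBddFun.const _).mul hb1).add ((IsBddFun.const _).mul hb2))) fun Z => ?_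
  have hbd : IsBddFun fun v : Fin (n + 1) → Y' => |avg φ v - a / b| := ⟨B, hB⟩
  set p := (resampleIndex fun i => w (Z i)).bind fun i => κ (Z i) with hp
  set m := p.mean φ with hm
  set A := avg (fun y => (w y).toReal * (κ y).mean φ) Z with hA
  set W := avg (fun y => (w y).toReal) Z with hW
  have hmW : m * W = A := by
    have := mean_resampleIndex (w := fun i => w (Z i))
      (fun i => ne_top_of_le_ne_top ENNReal.one_ne_top (hw _)) fun i => (κ (Z i)).mean φ
    rw [hm, hp, PMF.mean_bind _ _ hφ, hW, hA, avg, avg, ← this]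
    ring
  have hmK : |m| ≤ K := p.abs_mean_le hK
  -- Since `m * W = A` and `|m| ≤ K`, only the limit `b` is divided by; no lower bound on the random
  -- total weight `W` is needed.
  have hdet : |m - a / b| ≤ K / b * |W - b| + b⁻¹ * |A - a| := by
    have : m - a / b = -(m / b * (W - b)) + b⁻¹ * (A - a) := by
      rw [← hmW]
      field_simp
      ring
    rw [this]
    refine (abs_add_le _ _).trans ?_
    rw [abs_neg, abs_mul, abs_mul, abs_div, abs_of_pos hb, abs_of_pos (inv_pos.2 hb)]
    gcongr
  have hb3 : IsBddFun fun v : Fin (n + 1) → Y' => |avg φ v - m| :=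
    ((isBddFun_avg hφ _).sub (.const _)).abs
  calc (iid p (n + 1)).mean (fun v => |avg φ v - a / b|)
      ≤ (iid p (n + 1)).mean (fun v => |avg φ v - m| + |m - a / b|) :=
        PMF.mean_mono _ hbd (hb3.add (.const _)) fun v => abs_sub_le _ _ _
    _ = (iid p (n + 1)).mean (fun v => |avg φ v - m|) + |m - a / b| := by
        rw [PMF.mean_add _ hb3 (.const _), PMF.mean_const]
    _ ≤ _ := add_le_add (mean_iid_abs_avg_sub_le p hK n) hdet

/-- Convergence in mean implies convergence in probability. -/
theorem AvgTendsto.tendsto_toMeasure {Y : Type*} [∀ n, MeasurableSpace (Fin (n + 1) → Y)]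
    [∀ n, DiscreteMeasurableSpace (Fin (n + 1) → Y)]
    {P : ∀ n : ℕ, PMF (Fin (n + 1) → Y)} {φ : Y → ℝ} (hφ : IsBddFun φ) {c : ℝ}
    (h : AvgTendsto P φ c) {ε : ℝ} (hε : 0 < ε) :
    Tendsto (fun n => (P n).toMeasure {Z | ε ≤ |avg φ Z - c|}) atTop (𝓝 0) := by
  have hlim : Tendsto (fun n => ENNReal.ofReal (ε⁻¹ * (P n).mean fun Z => |avg φ Z - c|))
      atTop (𝓝 0) := by
    have := ENNReal.tendsto_ofReal (h.const_mul ε⁻¹)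
    simpa using this
  refine tendsto_of_tendsto_of_tendsto_of_le_of_le tendsto_const_nhds hlim (fun _ => zero_le)
    fun n => ?_
  have hb : IsBddFun fun Z : Fin (n + 1) → Y => |avg φ Z - c| :=
    ((isBddFun_avg hφ _).sub (.const _)).abs
  rw [← PMF.mean_const_mul, PMF.mean_eq_toReal _ fun Z => by positivity,
    ENNReal.ofReal_toReal ((P n).tsum_mul_ofReal_ne_top ((IsBddFun.const _).mul hb)),
    PMF.toMeasure_apply _ (.of_discrete)]
  -- Markov's inequality, term by term: the indicator of the event is at most `ε⁻¹ * |avg φ Z - c|`.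
  refine ENNReal.tsum_le_tsum fun Z => ?_
  by_cases hZ : ε ≤ |avg φ Z - c|
  · rw [Set.indicator_of_mem (show Z ∈ {Z | ε ≤ |avg φ Z - c|} from hZ)]
    refine le_mul_of_one_le_right zero_le ?_
    rw [ENNReal.one_le_ofReal, ← div_eq_inv_mul, one_le_div hε]
    exact hZ
  · rw [Set.indicator_of_notMem (show Z ∉ {Z | ε ≤ |avg φ Z - c|} from hZ)]
    exact zero_le

end BridgeSampling

/-! ### Feasibility and the limit of the particle system -/

namespace BridgeSampling

variable {X : Type*}

/-- The law of the path, up to time `k + 1`, of the chain with initial law `ν` and kernels `q`. -/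
noncomputable def chain (q : ℕ → X → PMF X) (ν : PMF X) : ℕ → PMF (ℕ → X)
  | 0 => ν.map fun g _ => g
  | k + 1 => (chain q ν k).bind fun z =>
      (q (k + 2) (z (k + 1))).map fun g => Function.update z (k + 2) g

theorem tsum_chain_succ_mul (q : ℕ → X → PMF X) (ν : PMF X) (k : ℕ) (φ : (ℕ → X) → ℝ≥0∞) :
    ∑' z, chain q ν (k + 1) z * φ z =
      ∑' z, chain q ν k z * ∑' g, q (k + 2) (z (k + 1)) g * φ (Function.update z (k + 2) g) := by
  rw [chain, PMF.tsum_bind_mul]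
  simp only [PMF.tsum_map_mul]

theorem mean_chain_succ (q : ℕ → X → PMF X) (ν : PMF X) (k : ℕ) {φ : (ℕ → X) → ℝ}
    (hφ : IsBddFun φ) :
    (chain q ν (k + 1)).mean φ = (chain q ν k).mean fun z =>
      (q (k + 2) (z (k + 1))).mean fun g => φ (Function.update z (k + 2) g) := by
  rw [chain, PMF.mean_bind _ _ hφ]
  congr 1
  funext z
  exact PMF.mean_map _ _ hφ

variable {q : ℕ → X → PMF X} {T : ℕ} {gT : X}

theorem bridgeLikelihood_eq_tsum {t : ℕ} (ht : t < T) (g : X) :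
    bridgeLikelihood q T gT t g =
      ∑' g', q (t + 1) g g' * bridgeLikelihood q T gT (t + 1) g' := by
  obtain ⟨n, rfl⟩ := Nat.exists_eq_add_of_lt ht
  rw [bridgeLikelihood, show t + n + 1 - t = n + 1 by lia, multiStep, PMF.bind_apply]
  simp only [bridgeLikelihood, show t + n + 1 - (t + 1) = n by lia]

theorem mem_feasible_iff {t : ℕ} (ht : t < T) (g : X) :
    g ∈ feasible q T gT t ↔ ∃ g' ∈ (q (t + 1) g).support, g' ∈ feasible q T gT (t + 1) := by
  simp only [feasible, Set.mem_ofPred_eq, pos_iff_ne_zero, bridgeLikelihood_eq_tsum ht, Ne,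
    ENNReal.tsum_eq_zero, not_forall, mul_eq_zero, not_or, PMF.mem_support_iff]

theorem mem_feasible_last_iff (g : X) : g ∈ feasible q T gT T ↔ g = gT := by
  have : bridgeLikelihood q T gT T g = PMF.pure g gT := by
    rw [bridgeLikelihood, Nat.sub_self, multiStep]
  rw [feasible, Set.mem_ofPred_eq, this, pos_iff_ne_zero, ← PMF.mem_support_iff,
    PMF.mem_support_pure_iff, eq_comm]

theorem mem_feasible_penultimate_iff {t : ℕ} (g : X) :
    g ∈ feasible q (t + 1) gT t ↔ gT ∈ (q (t + 1) g).support := by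
  rw [mem_feasible_iff (Nat.lt_succ_self t)]
  simp [mem_feasible_last_iff]

theorem tau_le_one (t : ℕ) (g : X) : tau q T gT t g ≤ 1 := by
  rw [← (q t g).tsum_coe]
  exact ENNReal.tsum_le_tsum fun x => Set.indicator_le_self _ _ x

theorem weight_le_one (t : ℕ) (z : ℕ → X) : weight q T gT t z ≤ 1 := by
  unfold weight
  split_ifs
  · exact le_rfl
  · exact tau_le_one _ _
  · exact mul_le_one' (PMF.coe_le_one _ _) (tau_le_one _ _)

/-- If `τ = 0`, every feasible successor has `q`-mass zero, so the arbitrary value of the proposal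
does not matter. If `τ ≠ 0`, then `g'` has a feasible successor and is itself feasible. Hence the
indicator on the left costs nothing; it is there because the limit of the weighted averages carries
it. -/
theorem proposal_mul_tau {t : ℕ} (ht : t < T) (g' g : X) :
    (feasible q T gT t).indicator (1 : X → ℝ) g' *
        ((proposal q T gT (t + 1) g' g).toReal * (tau q T gT (t + 1) g').toReal) =
      (q (t + 1) g' g).toReal * (feasible q T gT (t + 1)).indicator (1 : X → ℝ) g := by
  by_cases h : tau q T gT (t + 1) g' = 0
  · have := ENNReal.tsum_eq_zero.1 h g
    rw [h, ENNReal.toReal_zero, mul_zero, mul_zero]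
    by_cases hg : g ∈ feasible q T gT (t + 1)
    · rw [Set.indicator_of_mem hg] at this
      simp [this]
    · simp [hg]
  · have hg' : g' ∈ feasible q T gT t := by
      rw [mem_feasible_iff ht]
      obtain ⟨g₀, hg₀⟩ := not_forall.1 (mt ENNReal.tsum_eq_zero.2 h)
      have hmem : g₀ ∈ feasible q T gT (t + 1) := Set.mem_of_indicator_ne_zero hg₀
      rw [Set.indicator_of_mem hmem] at hg₀
      exact ⟨g₀, (PMF.mem_support_iff _ _).2 hg₀, hmem⟩
    rw [Set.indicator_of_mem hg', proposal_apply _ _ _ _ _ _ h, ← ENNReal.toReal_mul,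
      ENNReal.div_mul_cancel h (ne_top_of_le_ne_top ENNReal.one_ne_top (tau_le_one _ _))]
    by_cases hg : g ∈ feasible q T gT (t + 1) <;> simp [hg]

/-- A feasible state always has a feasible successor of positive probability, so a feasible path can
be extended up to time `T`. This yields the positivity of all normalizing constants. -/
theorem exists_feasible_mem_support_chain {ν : PMF X} (hν : ∀ g ∈ ν.support, g ∈ feasible q T gT 1)
    {k : ℕ} (hk : k + 1 ≤ T) :
    ∃ z ∈ (chain q ν k).support, z (k + 1) ∈ feasible q T gT (k + 1) := by
  induction k with
  | zero =>
    obtain ⟨g, hg⟩ := ν.support_nonempty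
    exact ⟨fun _ => g, (PMF.mem_support_map_iff _ _ _).2 ⟨g, hg, rfl⟩, hν g hg⟩
  | succ k ih =>
    obtain ⟨z, hz, hzf⟩ := ih (by lia)
    obtain ⟨g, hg, hgf⟩ := (mem_feasible_iff (by lia) _).1 hzf
    refine ⟨Function.update z (k + 2) g, ?_, by simpa using hgf⟩
    rw [chain, PMF.mem_support_bind_iff]
    exact ⟨z, hz, (PMF.mem_support_map_iff _ _ _).2 ⟨g, hg, rfl⟩⟩

/-- Feasibility passes backwards along transitions of positive probability. -/
theorem feasible_one_of_mem_support_chain {ν : PMF X} {k : ℕ} (hk : k + 1 ≤ T) {z : ℕ → X}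
    (hz : z ∈ (chain q ν k).support) (hzf : z (k + 1) ∈ feasible q T gT (k + 1)) :
    z 1 ∈ ν.support ∧ z 1 ∈ feasible q T gT 1 := by
  induction k generalizing z with
  | zero =>
    obtain ⟨g, hg, rfl⟩ := (PMF.mem_support_map_iff _ _ _).1 hz
    exact ⟨hg, hzf⟩
  | succ k ih =>
    rw [chain, PMF.mem_support_bind_iff] at hz
    obtain ⟨y, hy, hz⟩ := hz
    obtain ⟨g, hg, rfl⟩ := (PMF.mem_support_map_iff _ _ _).1 hz
    rw [Function.update_self] at hzf
    rw [Function.update_of_ne (by lia)]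
    exact ih (by lia) hy ((mem_feasible_iff (by lia) _).2 ⟨g, hg, hzf⟩)

/-- The weight of the transition that leads to time `t`, that is, the weight at time `t < T - 1`,
and the weight at time `t = T - 1` without the factor for the transition to the final state. -/
noncomputable def stepWeight (q : ℕ → X → PMF X) (T : ℕ) (gT : X) (t : ℕ) (z : ℕ → X) : ℝ≥0∞ :=
  if t ≤ 1 then 1 else tau q T gT t (z (t - 1))

theorem stepWeight_le_one (t : ℕ) (z : ℕ → X) : stepWeight q T gT t z ≤ 1 := by
  unfold stepWeight
  split_ifs
  · exact le_rfl
  · exact tau_le_one _ _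

theorem weight_eq_stepWeight {t : ℕ} (ht : t + 1 < T) : weight q T gT t = stepWeight q T gT t := by
  funext z
  simp only [weight, stepWeight, ht, if_true]

/-- The indicator of the paths whose state at time `t` is feasible. -/
noncomputable def feasInd (q : ℕ → X → PMF X) (T : ℕ) (gT : X) (t : ℕ) (z : ℕ → X) : ℝ :=
  (feasible q T gT t).indicator 1 (z t)

theorem isBddFun_feasInd (t : ℕ) : IsBddFun (feasInd q T gT t) :=
  (IsBddFun.indicator_one _).comp fun z : ℕ → X => z t

theorem feasInd_nonneg (t : ℕ) (z : ℕ → X) : 0 ≤ feasInd q T gT t z :=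
  Set.indicator_nonneg (fun _ _ => zero_le_one) _

theorem mean_chain_feasInd_pos {ν : PMF X} (hν : ∀ g ∈ ν.support, g ∈ feasible q T gT 1)
    {k : ℕ} (hk : k + 1 ≤ T) : 0 < (chain q ν k).mean (feasInd q T gT (k + 1)) := by
  obtain ⟨z, hz, hzf⟩ := exists_feasible_mem_support_chain hν hk
  refine PMF.mean_pos _ (isBddFun_feasInd _) (feasInd_nonneg _) hz ?_
  rw [feasInd, Set.indicator_of_mem hzf]
  exact one_pos

/-- `proposal_mul_tau` summed over the new state. The weight at time `k + 2` depends only on the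
state at `k + 1`, which the update leaves alone. -/
theorem mean_proposal_stepWeight {k : ℕ} (hk : k + 1 < T) (z : ℕ → X) {φ : (ℕ → X) → ℝ}
    (hφ : IsBddFun φ) :
    feasInd q T gT (k + 1) z *
        ((proposal q T gT (k + 2) (z (k + 1))).map fun g => Function.update z (k + 2) g).mean
          (fun y => (stepWeight q T gT (k + 2) y).toReal * φ y) =
      (q (k + 2) (z (k + 1))).mean fun g =>
        feasInd q T gT (k + 2) (Function.update z (k + 2) g) *
          φ (Function.update z (k + 2) g) := by
  rw [PMF.mean_map _ _ ((IsBddFun.toReal (stepWeight_le_one _)).mul hφ), PMF.mean, PMF.mean,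
    ← tsum_mul_left]
  refine tsum_congr fun g => ?_
  have h := proposal_mul_tau (q := q) (gT := gT) hk (z (k + 1)) g
  have hw : stepWeight q T gT (k + 2) (Function.update z (k + 2) g) =
      tau q T gT (k + 2) (z (k + 1)) := by
    rw [stepWeight, if_neg (by lia), Function.update_of_ne (by lia)]
    rfl
  rw [hw]
  simp only [feasInd, Function.update_self]
  rw [← mul_assoc (q _ _ _).toReal, ← h]
  ring

/-- Averages over the particles, weighted by the last transition, estimate up to a normalizing
constant the expectation over the paths of the chain whose last state is feasible. -/
theorem exists_avgTendsto_particles {ν : PMF X} (hν : ∀ g ∈ ν.support, g ∈ feasible q T gT 1)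
    {k : ℕ} (hk : k + 1 < T) :
    ∃ c : ℝ, 0 < c ∧ ∀ φ : (ℕ → X) → ℝ, IsBddFun φ →
      AvgTendsto (fun n => particles q T gT ν (n + 1) k)
        (fun z => (stepWeight q T gT (k + 1) z).toReal * φ z)
        (c * (chain q ν k).mean fun z => feasInd q T gT (k + 1) z * φ z) := by
  induction k with
  | zero =>
    refine ⟨1, one_pos, fun φ hφ => ?_⟩
    have h : (chain q ν 0).mean (fun z => feasInd q T gT (0 + 1) z * φ z) =
        (chain q ν 0).mean φ := by
      refine PMF.mean_congr _ fun z hz => ?_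
      obtain ⟨g, hg, rfl⟩ := (PMF.mem_support_map_iff _ _ _).1 hz
      rw [feasInd, Set.indicator_of_mem (hν g hg), Pi.one_apply, one_mul]
    rw [h, one_mul]
    have h0 : AvgTendsto (fun n => particles q T gT ν (n + 1) 0) φ ((chain q ν 0).mean φ) :=
      avgTendsto_iid (chain q ν 0) hφ
    simpa [stepWeight] using h0
  | succ k ih =>
    obtain ⟨c, hc, ih⟩ := ih (by lia)
    have hpos := mean_chain_feasInd_pos hν (show k + 1 ≤ T by lia)
    -- The selection step divides by the limit of the average weight, `c` times this mean; the old
    -- `c` cancels against the numerator.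
    refine ⟨((chain q ν k).mean (feasInd q T gT (k + 1)))⁻¹, inv_pos.2 hpos, fun φ hφ => ?_⟩
    have hwφ : IsBddFun fun y => (stepWeight q T gT (k + 2) y).toReal * φ y :=
      (IsBddFun.toReal (stepWeight_le_one _)).mul hφ
    obtain ⟨K, hK⟩ := hwφ
    have hwφ : IsBddFun fun y => (stepWeight q T gT (k + 2) y).toReal * φ y := ⟨K, hK⟩
    have ha := ih (fun z =>
      ((proposal q T gT (k + 2) (z (k + 1))).map fun g => Function.update z (k + 2) g).mean
          (fun y => (stepWeight q T gT (k + 2) y).toReal * φ y))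
      (PMF.isBddFun_mean _ fun _ => hK)
    have hb := ih (fun _ => 1) (.const 1)
    simp only [mul_one] at hb
    simp only [mean_proposal_stepWeight (show k + 1 < T by lia) _ hφ] at ha
    rw [← mean_chain_succ q ν k ((isBddFun_feasInd (k + 2)).mul hφ)] at ha
    have hmain := AvgTendsto.resample (stepWeight_le_one (k + 1))
      (fun z => (proposal q T gT (k + 2) (z (k + 1))).map fun g => Function.update z (k + 2) g)
      hwφ (mul_pos hc hpos) ha hb
    -- Time `k + 1` is still before `T - 1`, so the weights used for selection lack the final
    -- factor.
    rw [mul_div_mul_left _ _ hc.ne', div_eq_inv_mul, ← weight_eq_stepWeight (by lia)] at hmain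
    exact hmain

/-- The output of the sampler on the particles with paths up to time `T - 1`. -/
theorem AvgTendsto.bridgeSampler {ν : PMF X} {f : (Finset.Icc 1 T → X) → ℝ} (hf : IsBddFun f)
    {a b : ℝ} (hb : 0 < b)
    (ha : AvgTendsto (fun n => particles q T gT ν (n + 1) (T - 2))
      (fun z => (weight q T gT (T - 1) z).toReal *
        f ((Finset.Icc 1 T).restrict (Function.update z T gT))) a)
    (hwb : AvgTendsto (fun n => particles q T gT ν (n + 1) (T - 2))
      (fun z => (weight q T gT (T - 1) z).toReal) b) :
    AvgTendsto (fun n => bridgeSampler q T gT ν (n + 1)) f (a / b) := by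
  refine AvgTendsto.resample (weight_le_one _)
    (fun z => PMF.pure ((Finset.Icc 1 T).restrict (Function.update z T gT))) hf hb ?_ hwb
  simpa only [PMF.mean_pure] using ha

/-- Apply the particle limit at time `T - 1` to test functions containing the final transition
probability. Here `3 ≤ T` ensures `T - 1 ≥ 2`, so that the last weight does contain this factor. -/
theorem avgTendsto_bridgeSampler {ν : PMF X} (hT : 3 ≤ T)
    (hν : ∀ g ∈ ν.support, g ∈ feasible q T gT 1)
    {f : (Finset.Icc 1 T → X) → ℝ} (hf : IsBddFun f) :
    AvgTendsto (fun n => bridgeSampler q T gT ν (n + 1)) f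
      ((chain q ν (T - 2)).mean (fun z => (q T (z (T - 1)) gT).toReal *
          f ((Finset.Icc 1 T).restrict (Function.update z T gT))) /
        (chain q ν (T - 2)).mean (fun z => (q T (z (T - 1)) gT).toReal)) := by
  obtain ⟨k, rfl⟩ := Nat.exists_eq_add_of_le' hT
  obtain ⟨c, hc, h⟩ := exists_avgTendsto_particles hν (show k + 1 + 1 < k + 3 by lia)
  have hq : IsBddFun fun z : ℕ → X => (q (k + 3) (z (k + 2)) gT).toReal :=
    .toReal fun _ => PMF.coe_le_one _ _
  have hw : ∀ z, (weight q (k + 3) gT (k + 2) z).toReal =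
      (stepWeight q (k + 3) gT (k + 2) z).toReal * (q (k + 3) (z (k + 2)) gT).toReal := fun z => by
    rw [weight, stepWeight, if_neg (by lia), if_neg (by lia), if_neg (by lia), mul_comm,
      ENNReal.toReal_mul]
  -- A state that can reach `gT` in one step is feasible at time `T - 1`, so the indicator is
  -- absorbed.
  have hfeas : ∀ z : ℕ → X, feasInd q (k + 3) gT (k + 2) z * (q (k + 3) (z (k + 2)) gT).toReal =
      (q (k + 3) (z (k + 2)) gT).toReal := fun z => by
    by_cases hz : z (k + 2) ∈ feasible q (k + 3) gT (k + 2)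
    · rw [feasInd, Set.indicator_of_mem hz, Pi.one_apply, one_mul]
    · have : q (k + 3) (z (k + 2)) gT = 0 := by
        rw [PMF.apply_eq_zero_iff]
        exact mt (mem_feasible_penultimate_iff _).2 hz
      simp [this]
  have ha := h _ (hq.mul (hf.comp fun z : ℕ → X =>
    (Finset.Icc 1 (k + 3)).restrict (Function.update z (k + 3) gT)))
  have hb := h _ hq
  simp only [← mul_assoc, ← hw, hfeas] at ha hb
  have hpos : 0 < (chain q ν (k + 1)).mean fun z => (q (k + 3) (z (k + 2)) gT).toReal := by
    obtain ⟨z, hz, hzf⟩ := exists_feasible_mem_support_chain hν (show k + 1 + 1 ≤ k + 3 by lia)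
    refine PMF.mean_pos _ hq (fun _ => ENNReal.toReal_nonneg) hz ?_
    exact ENNReal.toReal_pos ((PMF.mem_support_iff _ _).1
      ((mem_feasible_penultimate_iff _).1 hzf)) (PMF.apply_ne_top _ _)
  have hmain := AvgTendsto.bridgeSampler hf (mul_pos hc hpos) ha hb
  rw [mul_div_mul_left _ _ hc.ne'] at hmain
  exact hmain

end BridgeSampling

/-! ### Finite graphs -/

theorem FinGraph.singleEdge_inj {V E : Type*} {g : FinGraph V E} {e e' : E} (he : e ∈ E(g.1))
    (h : g.singleEdge e = g.singleEdge e') : e = e' := by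
  obtain ⟨x, y, hxy⟩ := Graph.exists_isLink_of_mem_edgeSet he
  have h1 : (g.singleEdge e).1.IsLink e x y := ⟨rfl, hxy⟩
  rw [h] at h1
  exact h1.1

/-- A finite graph is determined by its finite vertex set and its finite set of link triples.
Countability makes every function of a finite-horizon path measurable and turns integrals into sums.
-/
instance FinGraph.instCountable {V E : Type*} [Countable V] [Countable E] :
    Countable (FinGraph V E) := by
  have : Countable {s : Set V // s.Finite} := Set.Countable.ofPred_finite.to_subtype
  have : Countable {s : Set (E × V × V) // s.Finite} := Set.Countable.ofPred_finite.to_subtype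
  have hfin : ∀ g : FinGraph V E, {p : E × V × V | g.1.IsLink p.1 p.2.1 p.2.2}.Finite := fun g =>
    (g.2.2.prod (g.2.1.prod g.2.1)).subset fun p hp =>
      ⟨hp.edge_mem, hp.left_mem, hp.right_mem⟩
  refine Function.Injective.countable (f := fun g : FinGraph V E =>
    ((⟨V(g.1), g.2.1⟩, ⟨_, hfin g⟩) :
      {s : Set V // s.Finite} × {s : Set (E × V × V) // s.Finite})) fun g g' h => ?_
  simp only [Prod.mk.injEq, Subtype.mk.injEq] at h
  exact Subtype.ext (Graph.ext h.1 fun e x y => Set.ext_iff.1 h.2 (e, x, y))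

/-! ### From the random process to the chain with kernels `q` -/

/-- Integration against the joint law of `U` and `W`, where `κ` is the conditional law of `W`
given `U`. -/
theorem lintegral_eq_lintegral_tsum_of_condLaw {Ω α β : Type*} [MeasurableSpace Ω]
    [MeasurableSpace α] [MeasurableSpace β] [Countable α] [Countable β]
    [MeasurableSingletonClass α] [MeasurableSingletonClass β] {μ : Measure Ω} {U : Ω → α}
    {W : Ω → β} (hU : Measurable U) (hW : Measurable W) (κ : α → PMF β)
    (h : ∀ a b, μ (U ⁻¹' {a} ∩ W ⁻¹' {b}) = μ (U ⁻¹' {a}) * κ a b) (F : α → β → ℝ≥0∞) :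
    ∫⁻ ω, F (U ω) (W ω) ∂μ = ∫⁻ ω, ∑' b, κ (U ω) b * F (U ω) b ∂μ := by
  have h1 := lintegral_map (μ := μ) (f := fun p : α × β => F p.1 p.2)
    (measurable_of_countable _) (hU.prodMk hW)
  have h2 := lintegral_map (μ := μ) (f := fun a : α => ∑' b, κ a b * F a b)
    (measurable_of_countable _) hU
  rw [← h1, ← h2, lintegral_countable', lintegral_countable', ENNReal.tsum_prod']
  refine tsum_congr fun a => ?_
  rw [← ENNReal.tsum_mul_right]
  refine tsum_congr fun b => ?_
  rw [Measure.map_apply hU (measurableSet_singleton _),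
    Measure.map_apply (hU.prodMk hW) (measurableSet_singleton _), ← Set.singleton_prod_singleton,
    Set.mk_preimage_prod, h]
  ring

/-- The path of the process up to time `k + 1`, with the entry `G 1` at all other times. -/
def processPath {X Ω : Type*} (G : ℕ → Ω → X) (k : ℕ) (ω : Ω) (s : ℕ) : X :=
  if 1 ≤ s ∧ s ≤ k + 1 then G s ω else G 1 ω

theorem processPath_apply {X Ω : Type*} (G : ℕ → Ω → X) {k s : ℕ} (h1 : 1 ≤ s) (h2 : s ≤ k + 1)
    (ω : Ω) : processPath G k ω s = G s ω := if_pos ⟨h1, h2⟩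

theorem processPath_zero {X Ω : Type*} (G : ℕ → Ω → X) (ω : Ω) :
    processPath G 0 ω = fun _ => G 1 ω := by
  funext s
  unfold processPath
  split_ifs with h
  · rw [show s = 1 by lia]
  · rfl

/-- Same recursion as `chain`, with the same filler entries outside the time range, so the two laws
can be compared on all of `ℕ → X`. -/
theorem processPath_succ {X Ω : Type*} (G : ℕ → Ω → X) (k : ℕ) (ω : Ω) :
    processPath G (k + 1) ω = Function.update (processPath G k ω) (k + 2) (G (k + 2) ω) := by
  funext s
  by_cases hs : s = k + 2
  · subst hs
    rw [Function.update_self, processPath_apply _ (by lia) (by lia)]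
  · rw [Function.update_of_ne hs]
    unfold processPath
    congr 1
    simp only [eq_iff_iff]
    lia

/-- Writing the path as a function of past and present lets the conditional law of the next state be
applied. For `k = 0` the past is empty and the filler `G 1` is the present state. -/
theorem exists_processPath_eq {X Ω : Type*} (G : ℕ → Ω → X) (k : ℕ) :
    ∃ e : (Finset.Ico 1 (k + 1) → X) × X → ℕ → X,
      ∀ ω, processPath G k ω = e (fun s => G s ω, G (k + 1) ω) := by
  refine ⟨fun p s => if h : s ∈ Finset.Ico 1 (k + 1) then p.1 ⟨s, h⟩ else
    if s = k + 1 then p.2 else if h : 1 ∈ Finset.Ico 1 (k + 1) then p.1 ⟨1, h⟩ else p.2,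
    fun ω => funext fun s => ?_⟩
  unfold processPath
  simp only [Finset.mem_Ico, le_refl, true_and]
  split_ifs <;> first | rfl | lia | skip
  rw [show k + 1 = 1 by lia]

namespace IsSequentialNetworkModel

variable {V E Ω : Type*} [MeasurableSpace Ω] {μ : Measure Ω} {T : ℕ} {G : ℕ → Ω → FinGraph V E}
  {q : ℕ → FinGraph V E → PMF (FinGraph V E)}

theorem measurable_past (hG : IsSequentialNetworkModel μ T G q) {t : ℕ} (ht : t ≤ T) :
    Measurable fun ω (s : Finset.Ico 1 t) => G s ω :=
  measurable_pi_iff.2 fun s => hG.measurable s (Finset.mem_Ico.1 s.2).1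
    ((Finset.mem_Ico.1 s.2).2.le.trans ht)

/-- Conditional independence given `G t = g` factors the joint probability, and the kernel
identifies one factor. If `G t = g` has probability zero, the kernel is unconstrained but both sides
are zero. -/
theorem measure_transition [Countable V] [Countable E] [IsProbabilityMeasure μ]
    (hG : IsSequentialNetworkModel μ T G q) {t : ℕ} (h1 : 1 ≤ t)
    (ht : t < T) (y : Finset.Ico 1 t → FinGraph V E) (g g' : FinGraph V E) :
    μ ((fun ω => ((fun s : Finset.Ico 1 t => G s ω), G t ω)) ⁻¹' {(y, g)} ∩
        G (t + 1) ⁻¹' {g'}) =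
      μ ((fun ω => ((fun s : Finset.Ico 1 t => G s ω), G t ω)) ⁻¹' {(y, g)}) *
        q (t + 1) g g' := by
  rw [← Set.singleton_prod_singleton, Set.mk_preimage_prod]
  set A := (fun ω (s : Finset.Ico 1 t) => G s ω) ⁻¹' {y}
  set B := G t ⁻¹' {g} with hB
  by_cases h0 : μ B = 0
  · have hAB : μ (A ∩ B) = 0 := measure_mono_null Set.inter_subset_right h0
    rw [hAB, zero_mul]
    exact measure_mono_null Set.inter_subset_left hAB
  · have hBm : MeasurableSet B := hG.measurable t h1 ht.le (measurableSet_singleton _)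
    have hind := (hG.markov t h1 ht g).measure_inter_preimage_eq_mul {g'} {y}
      (measurableSet_singleton _) (measurableSet_singleton _)
    rw [hG.kernel t h1 ht g h0 g', cond_apply hBm, cond_apply hBm] at hind
    have htop : μ B ≠ ∞ := measure_ne_top _ _
    have hind := congrArg (μ B * ·) hind
    beta_reduce at hind
    rw [← mul_assoc, ENNReal.mul_inv_cancel h0 htop, one_mul, mul_left_comm, ← mul_assoc (μ B),
      ENNReal.mul_inv_cancel h0 htop, one_mul, mul_comm] at hind
    rw [Set.inter_comm A B, ← hind]
    congr 1
    ext ω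
    simp only [Set.mem_inter_iff, A]
    tauto

open BridgeSampling

/-- The law of the path of the process on the event `G 1 ∈ S` is, up to the factor `c`, the law of
the chain with initial law `ν`, provided that this is so at time `1`. -/
theorem lintegral_processPath [Countable V] [Countable E] [IsProbabilityMeasure μ]
    (hG : IsSequentialNetworkModel μ T G q) {S : Set (FinGraph V E)} {ν : PMF (FinGraph V E)}
    {c : ℝ≥0∞} (hν : ∀ g, S.indicator (fun g => μ (G 1 ⁻¹' {g})) g = c * ν g) {k : ℕ}
    (hk : k + 1 ≤ T) (φ : (ℕ → FinGraph V E) → ℝ≥0∞) :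
    ∫⁻ ω, S.indicator 1 (G 1 ω) * φ (processPath G k ω) ∂μ = c * ∑' z, chain q ν k z * φ z := by
  induction k generalizing φ with
  | zero =>
    have h1 : Measurable (G 1) := hG.measurable 1 le_rfl (by lia)
    have h2 := lintegral_map (μ := μ)
      (f := fun g : FinGraph V E => S.indicator 1 g * φ fun _ => g) (measurable_of_countable _) h1
    simp only [processPath_zero]
    rw [← h2, lintegral_countable', chain, PMF.tsum_map_mul, ← ENNReal.tsum_mul_left]
    refine tsum_congr fun g => ?_
    rw [Measure.map_apply h1 (measurableSet_singleton _), ← mul_assoc c, ← hν]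
    by_cases hg : g ∈ S <;> simp [hg, mul_comm]
  | succ k ih =>
    obtain ⟨e, he⟩ := exists_processPath_eq G k
    have h1 : ∀ ω, processPath G k ω 1 = G 1 ω := processPath_apply G le_rfl (by lia)
    have h2 : ∀ ω, processPath G k ω (k + 1) = G (k + 1) ω :=
      processPath_apply G (by lia) le_rfl
    have hstep := lintegral_eq_lintegral_tsum_of_condLaw (μ := μ)
      ((hG.measurable_past (by lia)).prodMk (hG.measurable (k + 1) (by lia) (by lia)))
      (hG.measurable (k + 2) (by lia) hk) (fun p => q (k + 2) p.2)
      (fun p g' => hG.measure_transition (by lia) hk p.1 p.2 g')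
      (fun p g' => S.indicator 1 (e p 1) * φ (Function.update (e p) (k + 2) g'))
    simp only [← he, h1, ← processPath_succ] at hstep
    rw [hstep, tsum_chain_succ_mul, ← ih (by lia)]
    refine lintegral_congr fun ω => ?_
    rw [h2, ← ENNReal.tsum_mul_left]
    exact tsum_congr fun g => mul_left_comm _ _ _

/-- The event of positive probability becomes a path of the chain from `g` to `gT` in the support;
`gT` is feasible at time `T`, and feasibility passes back to time `1`. -/
theorem mem_feasible_one [Countable V] [Countable E] [IsProbabilityMeasure μ]
    (hG : IsSequentialNetworkModel μ T G q) (hT : 1 ≤ T) {g gT : FinGraph V E}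
    (h : μ (G 1 ⁻¹' {g} ∩ G T ⁻¹' {gT}) ≠ 0) : g ∈ feasible q T gT 1 := by
  obtain ⟨k, rfl⟩ := Nat.exists_eq_add_of_le' hT
  have hν : ∀ x, ({g} : Set (FinGraph V E)).indicator (fun g => μ (G 1 ⁻¹' {g})) x =
      μ (G 1 ⁻¹' {g}) * PMF.pure g x := fun x => by
    by_cases hx : x = g <;> simp [hx]
  have hlaw := hG.lintegral_processPath hν le_rfl
    fun z => ({gT} : Set (FinGraph V E)).indicator 1 (z (k + 1))
  have hm : MeasurableSet (G 1 ⁻¹' {g} ∩ G (k + 1) ⁻¹' {gT}) :=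
    (hG.measurable 1 le_rfl hT (measurableSet_singleton _)).inter
      (hG.measurable (k + 1) hT le_rfl (measurableSet_singleton _))
  have hint : ∫⁻ ω, ({g} : Set (FinGraph V E)).indicator 1 (G 1 ω) *
      ({gT} : Set (FinGraph V E)).indicator 1 (processPath G k ω (k + 1)) ∂μ =
      μ (G 1 ⁻¹' {g} ∩ G (k + 1) ⁻¹' {gT}) := by
    rw [← lintegral_indicator_one hm]
    refine lintegral_congr fun ω => ?_
    rw [processPath_apply _ hT le_rfl, Set.inter_indicator_one]
    rfl
  rw [← hint, hlaw, mul_ne_zero_iff] at h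
  obtain ⟨z, hz⟩ := not_forall.1 (mt ENNReal.tsum_eq_zero.2 h.2)
  rw [← Ne, mul_ne_zero_iff] at hz
  have hzT : z (k + 1) = gT :=
    Set.mem_of_indicator_ne_zero (s := {gT}) (f := (1 : FinGraph V E → ℝ≥0∞)) hz.2
  obtain ⟨h1, h2⟩ := feasible_one_of_mem_support_chain le_rfl ((PMF.mem_support_iff _ _).2 hz.1)
    ((mem_feasible_last_iff _).2 hzT)
  rwa [(PMF.mem_support_pure_iff _ _).1 h1] at h2

theorem measurable_restrict (hG : IsSequentialNetworkModel μ T G q) :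
    Measurable fun ω (t : Finset.Icc 1 T) => G t ω :=
  measurable_pi_iff.2 fun s => hG.measurable s (Finset.mem_Icc.1 s.2).1 (Finset.mem_Icc.1 s.2).2

theorem integrable_comp [Countable V] [Countable E] [IsProbabilityMeasure μ]
    (hG : IsSequentialNetworkModel μ T G q) {f : (Finset.Icc 1 T → FinGraph V E) → ℝ}
    (hf : IsBddFun f) (A : Set Ω) :
    Integrable (fun ω => f fun t => G t ω) (μ.restrict A) := by
  obtain ⟨K, hK⟩ := hf
  exact .of_bound ((measurable_of_countable f).comp hG.measurable_restrict).aestronglyMeasurable K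
    (.of_forall fun ω => hK _)

/-- The chain is followed up to `T - 1` and the last transition is summed out: on `G T = gT` only
the term of `gT` survives, leaving `q T (z (T - 1)) gT` and the completed path. -/
theorem setIntegral_eq_mean_chain [Countable V] [Countable E] [IsProbabilityMeasure μ]
    (hG : IsSequentialNetworkModel μ T G q) (hT : 2 ≤ T) {S : Set (FinGraph V E)}
    {ν : PMF (FinGraph V E)} {c : ℝ≥0∞}
    (hν : ∀ g, S.indicator (fun g => μ (G 1 ⁻¹' {g})) g = c * ν g) (gT : FinGraph V E)
    {f : (Finset.Icc 1 T → FinGraph V E) → ℝ} (hf : IsBddFun f) :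
    ∫ ω in G 1 ⁻¹' S ∩ G T ⁻¹' {gT}, f (fun t => G t ω) ∂μ =
      c.toReal * (chain q ν (T - 2)).mean fun z => (q T (z (T - 1)) gT).toReal *
        f ((Finset.Icc 1 T).restrict (Function.update z T gT)) := by
  have hA : MeasurableSet (G 1 ⁻¹' S ∩ G T ⁻¹' {gT}) :=
    (hG.measurable 1 le_rfl (by lia) (.of_discrete)).inter
      (hG.measurable T (by lia) le_rfl (measurableSet_singleton _))
  have hq : IsBddFun fun z : ℕ → FinGraph V E => (q T (z (T - 1)) gT).toReal :=
    .toReal fun _ => PMF.coe_le_one _ _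
  have hr : ∀ {h : (Finset.Icc 1 T → FinGraph V E) → ℝ}, IsBddFun h →
      IsBddFun fun z : ℕ → FinGraph V E => (q T (z (T - 1)) gT).toReal *
        h ((Finset.Icc 1 T).restrict (Function.update z T gT)) := fun hh =>
    hq.mul (hh.comp fun z : ℕ → FinGraph V E =>
      (Finset.Icc 1 T).restrict (Function.update z T gT))
  have key : ∀ h : (Finset.Icc 1 T → FinGraph V E) → ℝ, (∀ x, 0 ≤ h x) →
      ∫ ω in G 1 ⁻¹' S ∩ G T ⁻¹' {gT}, h (fun t => G t ω) ∂μ =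
      c.toReal * (chain q ν (T - 2)).mean fun z => (q T (z (T - 1)) gT).toReal *
        h ((Finset.Icc 1 T).restrict (Function.update z T gT)) := by
    intro h h0
    rw [integral_eq_lintegral_of_nonneg_ae (.of_forall fun ω => h0 _)
      ((measurable_of_countable h).comp hG.measurable_restrict).aestronglyMeasurable,
      PMF.mean_eq_toReal _ fun z => mul_nonneg ENNReal.toReal_nonneg (h0 _), ← ENNReal.toReal_mul,
      ← lintegral_indicator hA]
    congr 1
    obtain ⟨k, rfl⟩ := Nat.exists_eq_add_of_le' hT
    have hlaw := hG.lintegral_processPath hν le_rfl fun z =>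
      ({gT} : Set (FinGraph V E)).indicator 1 (z (k + 2)) *
        ENNReal.ofReal (h ((Finset.Icc 1 (k + 2)).restrict z))
    rw [tsum_chain_succ_mul] at hlaw
    refine Eq.trans (lintegral_congr fun ω => ?_) (hlaw.trans ?_)
    · have hpath : (Finset.Icc 1 (k + 2)).restrict (processPath G (k + 1) ω) =
          fun t : Finset.Icc 1 (k + 2) => G t ω := funext fun t =>
        processPath_apply _ (Finset.mem_Icc.1 t.2).1 (Finset.mem_Icc.1 t.2).2 _
      rw [hpath, processPath_apply _ (by lia) le_rfl]
      by_cases h1 : G 1 ω ∈ S <;> by_cases h2 : G (k + 2) ω = gT <;>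
        simp [Set.indicator, h1, h2]
    · congr 1
      refine tsum_congr fun z => ?_
      congr 1
      rw [tsum_eq_single gT fun g hg => by simp [hg], Function.update_self,
        Set.indicator_of_mem (Set.mem_singleton _), Pi.one_apply, one_mul,
        ENNReal.ofReal_mul ENNReal.toReal_nonneg, ENNReal.ofReal_toReal (PMF.apply_ne_top _ _)]
      rfl
  obtain ⟨K, hK⟩ := hf
  have hf : IsBddFun f := ⟨K, hK⟩
  have hK0 : 0 ≤ K := (abs_nonneg _).trans (hK fun _ => gT)
  -- The nonnegative case, applied to `f + K` and to `K`, gives `f` by subtraction.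
  have h1 := key (fun x => f x + K) fun x => by linarith [neg_abs_le (f x), hK x]
  have h2 := key (fun _ => K) fun _ => hK0
  rw [integral_add (hG.integrable_comp hf _) (integrable_const _), h2] at h1
  simp only [mul_add] at h1
  rw [PMF.mean_add _ (hr hf) (hr (.const K)), mul_add] at h1
  linarith

/-- Divide the set integral of `f` by that of `1`; the factor `c` cancels, so only the shape of the
law of `G 1` on `S` matters. -/
theorem integral_cond_eq_mean_chain [Countable V] [Countable E] [IsProbabilityMeasure μ]
    (hG : IsSequentialNetworkModel μ T G q) (hT : 2 ≤ T) {S : Set (FinGraph V E)}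
    {ν : PMF (FinGraph V E)} {c : ℝ≥0∞}
    (hν : ∀ g, S.indicator (fun g => μ (G 1 ⁻¹' {g})) g = c * ν g) {gT : FinGraph V E}
    (h0 : μ (G 1 ⁻¹' S ∩ G T ⁻¹' {gT}) ≠ 0)
    {f : (Finset.Icc 1 T → FinGraph V E) → ℝ} (hf : IsBddFun f) :
    ∫ ω, f (fun t => G t ω) ∂μ[|G 1 ⁻¹' S ∩ G T ⁻¹' {gT}] =
      (chain q ν (T - 2)).mean (fun z => (q T (z (T - 1)) gT).toReal *
          f ((Finset.Icc 1 T).restrict (Function.update z T gT))) /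
        (chain q ν (T - 2)).mean (fun z => (q T (z (T - 1)) gT).toReal) := by
  have h1 := hG.setIntegral_eq_mean_chain hT hν gT hf
  have h2 := hG.setIntegral_eq_mean_chain hT hν gT (.const 1)
  simp only [mul_one, integral_const, smul_eq_mul, measureReal_restrict_apply_univ] at h2
  have h3 : μ.real (G 1 ⁻¹' S ∩ G T ⁻¹' {gT}) ≠ 0 :=
    (ENNReal.toReal_pos h0 (measure_ne_top _ _)).ne'
  rw [ProbabilityTheory.cond, integral_smul_measure, h1, ENNReal.toReal_inv, smul_eq_mul]
  change (μ.real _)⁻¹ * _ = _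
  rw [h2] at h3 ⊢
  rw [← div_eq_inv_mul, mul_div_mul_left _ _ (left_ne_zero_of_mul h3)]

theorem consistentFor [Countable V] [Countable E] [IsProbabilityMeasure μ]
    (hG : IsSequentialNetworkModel μ T G q) (hT : 3 ≤ T) {S : Set (FinGraph V E)}
    {ν : PMF (FinGraph V E)} {c : ℝ≥0∞}
    (hν : ∀ g, S.indicator (fun g => μ (G 1 ⁻¹' {g})) g = c * ν g) {gT : FinGraph V E}
    (hsupp : ∀ g ∈ ν.support, μ (G 1 ⁻¹' {g} ∩ G T ⁻¹' {gT}) ≠ 0)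
    (h0 : μ (G 1 ⁻¹' S ∩ G T ⁻¹' {gT}) ≠ 0)
    {f : (Finset.Icc 1 T → FinGraph V E) → ℝ} (hf : IsBddFun f) :
    ConsistentFor q T gT ν f (∫ ω, f (fun t => G t ω) ∂μ[|G 1 ⁻¹' S ∩ G T ⁻¹' {gT}]) := by
  rw [hG.integral_cond_eq_mean_chain (by lia) hν h0 hf]
  exact fun ε hε => (avgTendsto_bridgeSampler hT
    (fun g hg => hG.mem_feasible_one (by lia) (hsupp g hg)) hf).tendsto_toMeasure hf hε

/-- For `T ≤ 2` a path is determined by its first and last states. -/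
theorem consistentFor_of_le_two [Countable V] [Countable E] [IsProbabilityMeasure μ]
    (hG : IsSequentialNetworkModel μ T G q) (hT1 : 1 ≤ T) (hT2 : T ≤ 2) {g₁ gT : FinGraph V E}
    (h0 : μ (G 1 ⁻¹' {g₁} ∩ G T ⁻¹' {gT}) ≠ 0)
    {f : (Finset.Icc 1 T → FinGraph V E) → ℝ} (hf : IsBddFun f) :
    ConsistentFor q T gT (PMF.pure g₁) f
      (∫ ω, f (fun t => G t ω) ∂μ[|G 1 ⁻¹' {g₁} ∩ G T ⁻¹' {gT}]) := by
  have hA : MeasurableSet (G 1 ⁻¹' {g₁} ∩ G T ⁻¹' {gT}) :=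
    (hG.measurable 1 le_rfl hT1 (measurableSet_singleton _)).inter
      (hG.measurable T hT1 le_rfl (measurableSet_singleton _))
  have hpath : ∀ ω ∈ G 1 ⁻¹' {g₁} ∩ G T ⁻¹' {gT}, (fun t : Finset.Icc 1 T => G t ω) =
      (Finset.Icc 1 T).restrict (Function.update (fun _ => g₁) T gT) := by
    rintro ω ⟨h1, h2⟩
    funext ⟨t, ht⟩
    rw [Finset.mem_Icc] at ht
    by_cases htT : t = T
    · subst htT
      simpa using h2
    · have : t = 1 := by lia
      subst this
      simpa [htT] using h1
  have hint : ∫ ω, f (fun t => G t ω) ∂μ[|G 1 ⁻¹' {g₁} ∩ G T ⁻¹' {gT}] =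
      f ((Finset.Icc 1 T).restrict (Function.update (fun _ => g₁) T gT)) := by
    have := cond_isProbabilityMeasure h0
    rw [integral_congr_ae (g := fun _ =>
      f ((Finset.Icc 1 T).restrict (Function.update (fun _ => g₁) T gT)))
      ((ae_cond_mem hA).mono fun ω hω => congrArg f (hpath ω hω))]
    simp
  -- `T - 1 ≤ 1`, so there is no mutation and no reweighting: the output is the point mass at the
  -- only possible path. For `T = 1` the completion overwrites `g₁` by `gT`, which agrees on the
  -- conditioning event.
  have hw : ∀ z, weight q T gT (T - 1) z = 1 := fun z => if_pos (by lia)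
  have hiid : ∀ {φ : (ℕ → FinGraph V E) → ℝ}, IsBddFun φ →
      AvgTendsto (fun n => particles q T gT (PMF.pure g₁) (n + 1) (T - 2)) φ (φ fun _ => g₁) := by
    intro φ hφ
    have := avgTendsto_iid ((PMF.pure g₁).map fun g (_ : ℕ) => g) hφ
    rw [PMF.mean_map _ _ hφ, PMF.mean_pure] at this
    rw [show T - 2 = 0 by lia]
    exact this
  have hmain := AvgTendsto.bridgeSampler (q := q) (ν := PMF.pure g₁) (gT := gT) hf one_pos
    (by
      simpa only [hw, ENNReal.toReal_one, one_mul] using hiid (hf.comp fun z : ℕ → FinGraph V E =>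
        (Finset.Icc 1 T).restrict (Function.update z T gT)))
    (by simpa only [hw, ENNReal.toReal_one] using hiid (.const 1))
  rw [div_one, ← hint] at hmain
  exact fun ε hε => hmain.tendsto_toMeasure hf hε

end IsSequentialNetworkModel

/-! ### Uniform single-edge start and the final assembly -/

theorem FinGraph.map_singleEdge_apply {V E : Type*} (g : FinGraph V E)
    (hE : g.2.2.toFinset.Nonempty) {e : E} (he : e ∈ E(g.1)) :
    ((PMF.uniformOfFinset g.2.2.toFinset hE).map g.singleEdge) (g.singleEdge e) =
      (g.2.2.toFinset.card : ℝ≥0∞)⁻¹ := by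
  rw [PMF.map_apply, tsum_eq_single e, if_pos rfl]
  swap
  · exact fun e' he' => if_neg fun h => he' (FinGraph.singleEdge_inj he h).symm
  exact PMF.uniformOfFinset_apply_of_mem hE (by simpa using he)

theorem proposition4p1 {V E Ω : Type*} [Countable V] [Countable E] [MeasurableSpace Ω]
    (μ : Measure Ω) [IsProbabilityMeasure μ] (T : ℕ) (hT : 1 ≤ T)
    (G : ℕ → Ω → FinGraph V E) (q : ℕ → FinGraph V E → PMF (FinGraph V E))
    (hG : IsSequentialNetworkModel μ T G q) (gT : FinGraph V E)
    (f : (Finset.Icc 1 T → FinGraph V E) → ℝ) (hf : ∃ C, ∀ z, |f z| ≤ C) :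
    -- fixed initial graph `g₁`
    (∀ g₁ : FinGraph V E, μ (G 1 ⁻¹' {g₁} ∩ G T ⁻¹' {gT}) ≠ 0 →
      BridgeSampling.ConsistentFor q T gT (PMF.pure g₁) f
        (∫ ω, f (fun t => G t ω) ∂μ[|G 1 ⁻¹' {g₁} ∩ G T ⁻¹' {gT}])) ∧
    -- the initial graph is a single edge, drawn uniformly from the edges of `gT`
    (3 ≤ T → ∀ hE : gT.2.2.toFinset.Nonempty,
      (∀ e ∈ E(gT.1), μ (G 1 ⁻¹' {gT.singleEdge e} ∩ G T ⁻¹' {gT}) ≠ 0) →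
      (∀ e ∈ E(gT.1), ∀ e' ∈ E(gT.1),
        μ (G 1 ⁻¹' {gT.singleEdge e}) = μ (G 1 ⁻¹' {gT.singleEdge e'})) →
      BridgeSampling.ConsistentFor q T gT
        ((PMF.uniformOfFinset gT.2.2.toFinset hE).map gT.singleEdge) f
        (∫ ω, f (fun t => G t ω) ∂μ[|G 1 ⁻¹' (gT.singleEdge '' E(gT.1)) ∩ G T ⁻¹' {gT}])) := by
  have hf : IsBddFun f := hf
  refine ⟨fun g₁ h0 => ?_, fun hT3 hE hpos heq => ?_⟩
  · rcases le_or_gt T 2 with h2 | h3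
    · exact hG.consistentFor_of_le_two hT h2 h0 hf
    · refine hG.consistentFor h3 (c := μ (G 1 ⁻¹' {g₁})) (fun g => ?_) (fun g hg => ?_) h0 hf
      · by_cases hg : g = g₁ <;> simp [hg]
      · rwa [(PMF.mem_support_pure_iff _ _).1 hg]
  · obtain ⟨e₀, he₀⟩ := hE
    rw [Set.Finite.mem_toFinset] at he₀
    have hE : gT.2.2.toFinset.Nonempty := ⟨e₀, by simpa using he₀⟩
    have hsupp : ∀ g ∈ ((PMF.uniformOfFinset gT.2.2.toFinset hE).map gT.singleEdge).support,
        ∃ e ∈ E(gT.1), gT.singleEdge e = g := fun g hg => by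
      obtain ⟨e, he, rfl⟩ := (PMF.mem_support_map_iff _ _ _).1 hg
      exact ⟨e, by simpa using (PMF.mem_support_uniformOfFinset_iff hE e).1 he, rfl⟩
    refine hG.consistentFor hT3
      -- Each single-edge subgraph has mass `1 / card` under the initial law, because distinct edges
      -- give distinct subgraphs; multiplying by `card` times the common probability recovers the
      -- law of `G 1` on these graphs.
      (c := gT.2.2.toFinset.card * μ (G 1 ⁻¹' {gT.singleEdge e₀})) (fun g => ?_) (fun g hg => ?_)
      (fun h => hpos e₀ he₀ (measure_mono_null (Set.inter_subset_inter_left _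
        (Set.preimage_mono (Set.singleton_subset_iff.2 (Set.mem_image_of_mem _ he₀)))) h)) hf
    · by_cases hg : g ∈ gT.singleEdge '' E(gT.1)
      · obtain ⟨e, he, rfl⟩ := hg
        rw [Set.indicator_of_mem (Set.mem_image_of_mem _ he), FinGraph.map_singleEdge_apply _ hE he,
          heq e he e₀ he₀, mul_comm, ← mul_assoc, ENNReal.inv_mul_cancel _ (by simp), one_mul]
        exact Nat.cast_ne_zero.2 (Finset.card_ne_zero.2 hE)
      · rw [Set.indicator_of_notMem hg, (PMF.apply_eq_zero_iff _ _).2 fun h => hg (hsupp g h),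
          mul_zero]
    · obtain ⟨e, he, rfl⟩ := hsupp g hg
      exact hpos e he
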